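/- Let $X\in\mathbb{R}^{N\times d}$ and let $X=U\Sigma V^{\mathsf T}$ be a singular value decomposition: $U$ and $V$ have orthonormal columns and $\Sigma$ is (rectangular) diagonal with the singular values $\sigma_1\ge\sigma_2\ge\cdots\ge 0$ of $X$ on its diagonal in decreasing order (the compact decomposition, with $\operatorname{rk}X$ columns in $U$ and $V$, as well as larger ones up to the full decomposition are allowed); put $\sigma_j=0$ for $j>\operatorname{rk}X$. Let $k$ be at most the number of columns of $V$, let $V_k\in\mathbb{R}^{d\times k}$ consist of the first $k$ columns of $V$, and let $p$ be the number of nonzero rows of $V_k$ (the number of nonzero $k$-leverage scores). Let $y=Xw^*+\xi\in\mathbb{R}^N$ with $w^*\in\mathbb{R}^d$ fixed, where $\xi_1,\dots,\xi_N$ are i.i.d. real random variables with mean $0$ and finite variance $v$. For an estimator $w=w(X,y)\in\mathbb{R}^d$ let its excess risk be $$\mathcal{E}(w)=\mathbb{E}_{\xi}\left[\frac{\|Xw^*-Xw\|_2^2}{N}\right].$$ For $S\subset\{1,\dots,d\}$ let $\mathbf S\in\{0,1\}^{d\times|S|}$ be the sampling matrix with $X\mathbf S=X_{:,S}$, and let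 $\hat w_S=\mathbf S\,(X\mathbf S)^{+}y\in\mathbb{R}^d$, where $^+$ is the Moore–Penrose inverse; this is the least-squares regressor on the columns $X_{:,S}$, padded with zeros outside $S$. Let $S$ be a random subset of $\{1,\dots,d\}$ drawn from the projection determinantal point process with marginal kernel $K=V_kV_k^{\mathsf T}$, that is, $\mathbb{P}(T\subset S)=\det\big([K_{i,j}]_{i,j\in T}\big)$ for all $T\subset\{1,\dots,d\}$ (with $\det K_\emptyset=1$). Then $$\mathbb{E}_{\mathrm{DPP}}\big[\mathcal{E}(\hat w_S)\big]\;\le\;\big(1+k(p-k)\big)\frac{\|w^*\|_2^2\,\sigma_{k+1}^2}{N}+\frac{vk}{N}.$$ -/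

import Mathlib

open MeasureTheory ProbabilityTheory

namespace ColumnSubset

/-- The four Penrose equations: `B` is the Moore–Penrose inverse of the real matrix `A`. -/
structure IsMoorePenrose {m n : Type*} [Fintype m] [Fintype n]
    (A : Matrix m n ℝ) (B : Matrix n m ℝ) : Prop where
  mul_mul_left : A * B * A = A
  mul_mul_right : B * A * B = B
  transpose_left : (A * B).transpose = A * B
  transpose_right : (B * A).transpose = B * A

/-- The Moore–Penrose inverse `A⁺ = W diag(λ⁻¹) Wᵀ Aᵀ`, where `AᵀA = W diag(λ) Wᵀ` is the spectral
decomposition of `AᵀA`, and `0⁻¹ = 0`. See `isMoorePenrose_pinv` and `IsMoorePenrose.eq_pinv`. -/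
noncomputable def pinv {m n : Type*} [Fintype m] [Fintype n] [DecidableEq n]
    (A : Matrix m n ℝ) : Matrix n m ℝ :=
  (Matrix.isHermitian_conjTranspose_mul_self A).eigenvectorUnitary.val
    * Matrix.diagonal
        (fun i => ((Matrix.isHermitian_conjTranspose_mul_self A).eigenvalues i)⁻¹)
    * ((Matrix.isHermitian_conjTranspose_mul_self A).eigenvectorUnitary.val).transpose
    * A.transpose

theorem isMoorePenrose_pinv {m n : Type*} [Fintype m] [Fintype n] [DecidableEq n]
    (A : Matrix m n ℝ) : IsMoorePenrose A (pinv A) := by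
  set hG := Matrix.isHermitian_conjTranspose_mul_self A with hGdef
  set W : Matrix n n ℝ := hG.eigenvectorUnitary.val with hW
  set D : Matrix n n ℝ := Matrix.diagonal hG.eigenvalues with hD
  set D' : Matrix n n ℝ := Matrix.diagonal (fun i => (hG.eigenvalues i)⁻¹) with hD'
  have hWW : W.transpose * W = 1 := by
    have h := (Matrix.mem_unitaryGroup_iff' (A := W)).1 hG.eigenvectorUnitary.2
    rwa [Matrix.star_eq_conjTranspose, Matrix.conjTranspose_eq_transpose_of_trivial] at h
  have hspec : A.transpose * A = W * D * W.transpose := by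
    have h := hG.spectral_theorem
    rw [Unitary.conjStarAlgAut_apply, Matrix.star_eq_conjTranspose,
      Matrix.conjTranspose_eq_transpose_of_trivial hG.eigenvectorUnitary.val] at h
    exact (congrArg (· * A) (Matrix.conjTranspose_eq_transpose_of_trivial A)).symm.trans h
  have hp : pinv A = W * D' * W.transpose * A.transpose := rfl
  have hDD : D * D' * D = D := by
    simp only [hD, hD', Matrix.diagonal_mul_diagonal]
    congr 1; funext i; exact mul_inv_mul_cancel _
  have haux : ∀ x : ℝ, x⁻¹ * x * x⁻¹ = x⁻¹ := by
    intro x; by_cases h : x = 0 <;> simp [h]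
  have hDD' : D' * D * D' = D' := by
    simp only [hD, hD', Matrix.diagonal_mul_diagonal]
    congr 1; funext i; exact haux _
  have hcomm : D * D' = D' * D := by
    simp only [hD, hD', Matrix.diagonal_mul_diagonal]
    congr 1; funext i; exact mul_comm _ _
  have hDt : D.transpose = D := Matrix.diagonal_transpose _
  have hD't : D'.transpose = D' := Matrix.diagonal_transpose _
  have hconj : ∀ E F : Matrix n n ℝ,
      (W * E * W.transpose) * (W * F * W.transpose) = W * (E * F) * W.transpose := by
    intro E F
    calc (W * E * W.transpose) * (W * F * W.transpose)
        = W * E * (W.transpose * W) * F * W.transpose := by simp only [Matrix.mul_assoc]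
      _ = W * (E * F) * W.transpose := by rw [hWW]; simp only [Matrix.mul_one, Matrix.mul_assoc]
  have hBA : pinv A * A = W * (D' * D) * W.transpose := by
    rw [hp, Matrix.mul_assoc _ A.transpose A, hspec, hconj]
  refine ⟨?_, ?_, ?_, ?_⟩
  · have hz : (A * (pinv A * A) - A).conjTranspose * (A * (pinv A * A) - A) = 0 := by
      have h1 : A.transpose * (A * (pinv A * A) - A) = 0 := by
        rw [Matrix.mul_sub, ← Matrix.mul_assoc, hspec, hBA, hconj, ← Matrix.mul_assoc D, hDD,
          sub_self]
      have h2 : A * (pinv A * A) - A = A * (pinv A * A - 1) := by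
        rw [Matrix.mul_sub, Matrix.mul_one]
      conv_lhs => rw [h2]
      rw [Matrix.conjTranspose_mul, Matrix.conjTranspose_eq_transpose_of_trivial A,
        Matrix.mul_assoc, ← h2, h1, Matrix.mul_zero]
    rw [Matrix.mul_assoc]
    exact sub_eq_zero.1 (Matrix.conjTranspose_mul_self_eq_zero.1 hz)
  · rw [hBA, hp, ← Matrix.mul_assoc, hconj, hDD']
  · rw [hp]
    simp only [Matrix.transpose_mul, Matrix.transpose_transpose, hD't, Matrix.mul_assoc]
  · rw [hBA]
    simp only [Matrix.transpose_mul, Matrix.transpose_transpose, hD't, hDt, hcomm,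
      Matrix.mul_assoc]

theorem IsMoorePenrose.eq_pinv {m n : Type*} [Fintype m] [Fintype n] [DecidableEq n]
    {A : Matrix m n ℝ} {B : Matrix n m ℝ} (hB : IsMoorePenrose A B) : B = pinv A := by
  have hC := isMoorePenrose_pinv A
  set C := pinv A
  have h1 : A * B = A * C := by
    calc A * B = (A * B).transpose := hB.transpose_left.symm
      _ = (A * C * (A * B)).transpose := by
        rw [← Matrix.mul_assoc, hC.mul_mul_left]
      _ = A * B * (A * C) := by
        rw [Matrix.transpose_mul, hB.transpose_left, hC.transpose_left]
      _ = A * C := by rw [← Matrix.mul_assoc, hB.mul_mul_left]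
  have h2 : B * A = C * A := by
    calc B * A = (B * A).transpose := hB.transpose_right.symm
      _ = (B * A * (C * A)).transpose := by
        rw [Matrix.mul_assoc, ← Matrix.mul_assoc A C A, hC.mul_mul_left]
      _ = C * A * (B * A) := by
        rw [Matrix.transpose_mul, hB.transpose_right, hC.transpose_right]
      _ = C * A := by rw [Matrix.mul_assoc, ← Matrix.mul_assoc A B A, hB.mul_mul_left]
  calc B = B * A * B := hB.mul_mul_right.symm
    _ = C * A * B := by rw [h2]
    _ = C * (A * C) := by rw [Matrix.mul_assoc, h1]
    _ = C := by rw [← Matrix.mul_assoc, hC.mul_mul_right]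

/-- `sigma X j` is the `j`-th largest singular value of `X` for `j ≥ 1`, counted with multiplicity;
it is `0` for `j > rk X`. (Mathlib's sequence of singular values starts at index `0`.) -/
noncomputable def sigma {N d : ℕ} (X : Matrix (Fin N) (Fin d) ℝ) (j : ℕ) : ℝ :=
  (Matrix.toEuclideanLin X).singularValues (j - 1)

/-- `X = U Σ Vᵀ` is a singular value decomposition: `U` and `V` have orthonormal columns and `Σ` is
the `a × b` rectangular diagonal matrix with diagonal `σ₁(X) ≥ σ₂(X) ≥ ⋯`.
The compact decomposition is `a = b = rk X`, the full one is `a = N`, `b = d`. -/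
structure IsSVD {N d a b : ℕ} (X : Matrix (Fin N) (Fin d) ℝ)
    (U : Matrix (Fin N) (Fin a) ℝ) (V : Matrix (Fin d) (Fin b) ℝ) : Prop where
  orthonormal_left : U.transpose * U = 1
  orthonormal_right : V.transpose * V = 1
  eq_mul : X = U * Matrix.of (fun (i : Fin a) (j : Fin b) =>
      if (i : ℕ) = (j : ℕ) then sigma X ((j : ℕ) + 1) else 0) * V.transpose

/-- The first `k` columns of `V`. -/
def firstCols {d b k : ℕ} (V : Matrix (Fin d) (Fin b) ℝ) (hk : k ≤ b) :
    Matrix (Fin d) (Fin k) ℝ :=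
  V.submatrix id (Fin.castLE hk)

/-- The number of nonzero `k`-leverage scores, that is, of nonzero rows of `V_k`. -/
noncomputable def sparsityLevel {d k : ℕ} (Vk : Matrix (Fin d) (Fin k) ℝ) : ℕ :=
  {i : Fin d | Vk i ≠ 0}.ncard

/-- The law `μ` of a random subset `Y` of the index set is that of the determinantal point process
with marginal kernel `K`: `ℙ(T ⊆ Y) = det K_T` for all `T`. -/
def IsDPP {d : ℕ} (K : Matrix (Fin d) (Fin d) ℝ) (μ : PMF (Finset (Fin d))) : Prop :=
  ∀ T : Finset (Fin d),
    (∑ Y : Finset (Fin d) with T ⊆ Y, (μ Y).toReal) =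
      (K.submatrix (fun i : T => (i : Fin d)) (fun i : T => (i : Fin d))).det

/-- The expectation of `f Y` for a random subset `Y` with law `μ`. -/
noncomputable def expect {d : ℕ} (μ : PMF (Finset (Fin d))) (f : Finset (Fin d) → ℝ) : ℝ :=
  ∑ Y : Finset (Fin d), (μ Y).toReal * f Y

/-- The `d × |S|` zero-one sampling matrix of `S`, so that `M * samplingMatrix S = M_{:,S}`. -/
def samplingMatrix {d : ℕ} (S : Finset (Fin d)) : Matrix (Fin d) S ℝ :=
  (1 : Matrix (Fin d) (Fin d) ℝ).submatrix id (fun i : S => (i : Fin d))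

/-- The least-squares regressor of `y` on the columns `X_{:,S}`, as a vector of `ℝ^d`
supported on `S`. -/
noncomputable def sparseOLS {N d : ℕ} (X : Matrix (Fin N) (Fin d) ℝ) (S : Finset (Fin d))
    (y : EuclideanSpace ℝ (Fin N)) : EuclideanSpace ℝ (Fin d) :=
  WithLp.toLp 2 ((samplingMatrix S * pinv (X * samplingMatrix S)).mulVec y.ofLp)

/-- The response `y = X w* + ξ` of the well-specified linear model. -/
noncomputable def response {N d : ℕ} (X : Matrix (Fin N) (Fin d) ℝ)
    (wstar : EuclideanSpace ℝ (Fin d)) (noise : Fin N → ℝ) : EuclideanSpace ℝ (Fin N) :=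
  Matrix.toEuclideanLin X wstar + WithLp.toLp 2 noise

/-- The excess risk `𝔼_ξ [‖X w* - X w(y)‖² / N]` of an estimator `w` (a function of the response
`y = X w* + ξ`). -/
noncomputable def excessRisk {N d : ℕ} {Ω : Type*} [MeasurableSpace Ω] (P : Measure Ω)
    (X : Matrix (Fin N) (Fin d) ℝ) (wstar : EuclideanSpace ℝ (Fin d)) (ξ : Fin N → Ω → ℝ)
    (w : EuclideanSpace ℝ (Fin N) → EuclideanSpace ℝ (Fin d)) : ℝ :=
  ∫ ω, ‖Matrix.toEuclideanLin X wstar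
      - Matrix.toEuclideanLin X (w (response X wstar (fun i => ξ i ω)))‖ ^ 2 / (N : ℝ) ∂P

/-- The noises `ξ i` are i.i.d. with mean `0` and (finite) variance `v`. -/
structure IsIIDNoise {N : ℕ} {Ω : Type*} [MeasurableSpace Ω] (P : Measure Ω)
    (ξ : Fin N → Ω → ℝ) (v : ℝ) : Prop where
  indep : iIndepFun ξ P
  identDistrib : ∀ i j, IdentDistrib (ξ i) (ξ j) P P
  memLp : ∀ i, MemLp (ξ i) 2 P
  mean : ∀ i, (∫ ω, ξ i ω ∂P) = 0
  variance : ∀ i, ProbabilityTheory.variance (ξ i) P = v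

end ColumnSubset

/-!
Let `W = V_k` and let `u = Wᵀ w*`. Almost surely the rows of `W` in the sampled set `S` form a basis
of `ℝ^k`, so exactly one vector `q` supported on `S` satisfies `Wᵀ q = u`. The error `w* - q` is
orthogonal to the first `k` right singular vectors, so the bias of least squares on `S` is at most
`‖X (w* - q)‖² ≤ σ_{k+1}² ‖w* - q‖²`, while its variance is `v` times the rank of a projection.

It remains to average `‖w* - q‖²`. By Cramer's rule, `det W_S * q i` is the determinant of `W_S`
with row `i` replaced by `u`, and `det W_S ^ 2` is the probability of `S`. The Cauchy–Binet formula
for `W` with a replaced row then shows that `q` is unbiased, `𝔼 q = W u`, and that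
`𝔼 ‖q‖² ≤ (p - k + 1) ‖u‖²`. Hence `𝔼 ‖w* - q‖² ≤ ‖w*‖² + (p - k - 1) ‖u‖²`, which is at most
`max 1 (p - k) * ‖w*‖²`.
-/

namespace ColumnSubset

open scoped Matrix Nat

section CauchyBinet

variable {m n R : Type*} [Fintype n] [CommRing R]

theorem transpose_updateRow_mul_updateRow [DecidableEq n] (B C : Matrix n m R) (i : n)
    (u v : m → R) :
    (B.updateRow i u)ᵀ * C.updateRow i v =
      Bᵀ * C - Matrix.vecMulVec (B i) (C i) + Matrix.vecMulVec u v := by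
  ext j l
  have hrest : ∑ x ∈ Finset.univ.erase i, B.updateRow i u x j * C.updateRow i v x l =
      ∑ x ∈ Finset.univ.erase i, B x j * C x l :=
    Finset.sum_congr rfl fun x hx => by
      rw [Matrix.updateRow_ne (Finset.ne_of_mem_erase hx),
        Matrix.updateRow_ne (Finset.ne_of_mem_erase hx)]
  simp only [Matrix.add_apply, Matrix.sub_apply, Matrix.vecMulVec_apply, Matrix.mul_apply,
    Matrix.transpose_apply]
  rw [← Finset.add_sum_erase _ _ (Finset.mem_univ i), hrest,
    ← Finset.add_sum_erase _ (fun x => B x j * C x l) (Finset.mem_univ i)]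
  simp only [Matrix.updateRow_self]
  ring

variable [Fintype m] [DecidableEq m]

theorem det_transpose_mul_eq_sum (B C : Matrix n m R) :
    (Bᵀ * C).det = ∑ f : m → n, (∏ j, B (f j) j) * (C.submatrix f id).det := by
  have hrows : Bᵀ * C = fun j => ∑ i, B i j • C i := by
    ext j l
    simp [Matrix.mul_apply, Finset.sum_apply]
  rw [hrows]
  exact ((Matrix.detRowAlternating (n := m) (R := R)).toMultilinearMap.map_sum
    fun j i => B i j • C i).trans
      (Finset.sum_congr rfl fun f _ =>
        Matrix.det_mul_column (fun j => B (f j) j) (C.submatrix f id))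

/-- The Cauchy–Binet formula; summing over all maps `m → n` rather than over subsets of `n` counts
every subset `(card m)!` times. -/
theorem sum_det_submatrix_mul_det_submatrix (B C : Matrix n m R) :
    ∑ f : m → n, (B.submatrix f id).det * (C.submatrix f id).det =
      ((Fintype.card m)! : R) * (Bᵀ * C).det := by
  have permuted (s : Equiv.Perm m) :
      ∑ f : m → n, ((Equiv.Perm.sign s : ℤ) : R) * (∏ j, B (f (s j)) j) *
        (C.submatrix f id).det = (Bᵀ * C).det := by
    rw [det_transpose_mul_eq_sum]
    refine Fintype.sum_equiv (Equiv.arrowCongr s.symm (Equiv.refl n)) _ _ fun f => ?_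
    have hperm : (C.submatrix (f ∘ s) id).det =
        ((Equiv.Perm.sign s : ℤ) : R) * (C.submatrix f id).det :=
      Matrix.det_permute s (C.submatrix f id)
    change _ = (∏ j, B (f (s j)) j) * (C.submatrix (f ∘ s) id).det
    rw [hperm]
    ring
  calc ∑ f : m → n, (B.submatrix f id).det * (C.submatrix f id).det
      = ∑ f : m → n, ∑ s : Equiv.Perm m,
          ((Equiv.Perm.sign s : ℤ) : R) * (∏ j, B (f (s j)) j) * (C.submatrix f id).det := by
        simp only [Matrix.det_apply' (B.submatrix _ id), Finset.sum_mul, Matrix.submatrix_apply,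
          id_eq]
    _ = ∑ _s : Equiv.Perm m, (Bᵀ * C).det := by
        rw [Finset.sum_comm]
        exact Finset.sum_congr rfl fun s _ => permuted s
    _ = ((Fintype.card m)! : R) * (Bᵀ * C).det := by
        rw [Finset.sum_const, Finset.card_univ, Fintype.card_perm, nsmul_eq_mul]

theorem det_one_sub_vecMulVec_add_vecMulVec (a b u v : m → R) :
    (1 - Matrix.vecMulVec a b + Matrix.vecMulVec u v).det =
      (1 - a ⬝ᵥ b) * (1 + u ⬝ᵥ v) + (a ⬝ᵥ v) * (u ⬝ᵥ b) := by
  set P : Matrix m (Fin 2) R := Matrix.of fun j => ![-a j, u j] with hP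
  set Q : Matrix (Fin 2) m R := Matrix.of ![b, v] with hQ
  have hPQ : 1 - Matrix.vecMulVec a b + Matrix.vecMulVec u v = 1 + P * Q := by
    ext j l
    simp only [hP, hQ, Matrix.add_apply, Matrix.sub_apply, Matrix.vecMulVec_apply, Matrix.mul_apply,
      Fin.sum_univ_two, Matrix.of_apply, Matrix.cons_val_zero, Matrix.cons_val_one]
    ring
  have hQP : Q * P = !![-(a ⬝ᵥ b), u ⬝ᵥ b; -(a ⬝ᵥ v), u ⬝ᵥ v] := by
    ext x y
    fin_cases x <;> fin_cases y <;> simp [hP, hQ, Matrix.mul_apply, dotProduct, mul_comm]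
  rw [hPQ, Matrix.det_one_add_mul_comm, hQP, Matrix.det_fin_two]
  simp only [Matrix.add_apply, Matrix.one_apply_eq, Matrix.of_apply, Matrix.cons_val',
    Matrix.cons_val_zero, Matrix.cons_val_one, Matrix.cons_val_fin_one, ne_eq, zero_ne_one,
    one_ne_zero, not_false_eq_true, Matrix.one_apply_ne]
  ring

/-- The terms of the Cauchy–Binet sum that see row `i` are isolated by subtracting the sum in which
that row is replaced by `0`. -/
theorem sum_det_updateRow_mul_det_updateRow [DecidableEq n] {W : Matrix n m R}
    (hW : Wᵀ * W = 1) (i : n) (u v : m → R) :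
    (∑ f : m → n, if i ∈ Set.range f then
        ((W.updateRow i u).submatrix f id).det * ((W.updateRow i v).submatrix f id).det else 0) =
      ((Fintype.card m)! : R) * ((1 - W i ⬝ᵥ W i) * (u ⬝ᵥ v) + (W i ⬝ᵥ u) * (W i ⬝ᵥ v)) := by
  have total (x y : m → R) :
      ∑ f : m → n, ((W.updateRow i x).submatrix f id).det * ((W.updateRow i y).submatrix f id).det =
        ((Fintype.card m)! : R) *
          ((1 - W i ⬝ᵥ W i) * (1 + x ⬝ᵥ y) + (W i ⬝ᵥ y) * (x ⬝ᵥ W i)) := by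
    rw [sum_det_submatrix_mul_det_submatrix, transpose_updateRow_mul_updateRow, hW,
      det_one_sub_vecMulVec_add_vecMulVec]
  have isolate (f : m → n) :
      (if i ∈ Set.range f then
        ((W.updateRow i u).submatrix f id).det * ((W.updateRow i v).submatrix f id).det else 0) =
      ((W.updateRow i u).submatrix f id).det * ((W.updateRow i v).submatrix f id).det -
        ((W.updateRow i 0).submatrix f id).det * ((W.updateRow i 0).submatrix f id).det := by
    split_ifs with hi
    · obtain ⟨j, hj⟩ := hi
      have hzero : ((W.updateRow i 0).submatrix f id).det = 0 :=
        Matrix.det_eq_zero_of_row_eq_zero j fun l => by simp [hj]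
      rw [hzero, mul_zero, sub_zero]
    · have hunchanged (x : m → R) : (W.updateRow i x).submatrix f id = W.submatrix f id := by
        ext j l
        simp [Matrix.updateRow_ne fun hj : f j = i => hi ⟨j, hj⟩]
      simp only [hunchanged, sub_self]
  rw [Finset.sum_congr rfl fun f _ => isolate f, Finset.sum_sub_distrib, total, total,
    dotProduct_comm u (W i)]
  simp only [dotProduct_zero, zero_dotProduct]
  ring

end CauchyBinet

section OrthonormalColumns

theorem dotProduct_self_nonneg {n : Type*} [Fintype n] (x : n → ℝ) : 0 ≤ x ⬝ᵥ x := by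
  simpa only [star_trivial] using dotProduct_self_star_nonneg x

variable {m n : Type*} [Fintype m] [Fintype n]

theorem sum_ite_row_ne_zero (W : Matrix n m ℝ) :
    ∑ i, (if W i ≠ 0 then (1 : ℝ) else 0) = {i | W i ≠ 0}.ncard := by
  rw [Finset.sum_boole, ← Set.ncard_coe_finset]
  congr 2
  ext i
  simp

variable [DecidableEq m]

theorem mulVec_dotProduct_mulVec {R : Type*} [CommRing R] {W : Matrix n m R} (hW : Wᵀ * W = 1)
    (x y : m → R) : W *ᵥ x ⬝ᵥ W *ᵥ y = x ⬝ᵥ y := by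
  rw [Matrix.dotProduct_mulVec, ← Matrix.mulVec_transpose, Matrix.mulVec_mulVec, hW,
    Matrix.one_mulVec]

theorem transpose_mulVec_dotProduct_self_le {W : Matrix n m ℝ} (hW : Wᵀ * W = 1) (x : n → ℝ) :
    Wᵀ *ᵥ x ⬝ᵥ Wᵀ *ᵥ x ≤ x ⬝ᵥ x := by
  have hcross : x ⬝ᵥ W *ᵥ (Wᵀ *ᵥ x) = Wᵀ *ᵥ x ⬝ᵥ Wᵀ *ᵥ x := by
    rw [Matrix.dotProduct_mulVec, ← Matrix.mulVec_transpose]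
  have hres := dotProduct_self_nonneg (x - W *ᵥ (Wᵀ *ᵥ x))
  simp only [sub_dotProduct, dotProduct_sub, mulVec_dotProduct_mulVec hW, hcross,
    dotProduct_comm (W *ᵥ (Wᵀ *ᵥ x)) x] at hres
  linarith

theorem sum_row_dotProduct_self {R : Type*} [CommRing R] {W : Matrix n m R} (hW : Wᵀ * W = 1) :
    ∑ i, W i ⬝ᵥ W i = Fintype.card m := by
  have htrace : (W * Wᵀ).trace = Fintype.card m := by
    rw [Matrix.trace_mul_comm, hW, Matrix.trace_one]
  exact htrace

theorem row_dotProduct_self_le_one {W : Matrix n m ℝ} (hW : Wᵀ * W = 1) (i : n) :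
    W i ⬝ᵥ W i ≤ 1 := by
  classical
  have hbessel := transpose_mulVec_dotProduct_self_le hW (Pi.single i (1 : ℝ))
  rwa [Matrix.mulVec_single_one, dotProduct_single_one, Pi.single_eq_same] at hbessel

theorem card_le_ncard_row_ne_zero {W : Matrix n m ℝ} (hW : Wᵀ * W = 1) :
    Fintype.card m ≤ {i | W i ≠ 0}.ncard := by
  have hsum : (Fintype.card m : ℝ) ≤ ∑ i, if W i ≠ 0 then 1 else 0 := by
    rw [← sum_row_dotProduct_self hW]
    refine Finset.sum_le_sum fun i _ => ?_
    split_ifs with hi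
    · exact row_dotProduct_self_le_one hW i
    · rw [not_ne_iff.1 hi, zero_dotProduct]
  rwa [sum_ite_row_ne_zero, Nat.cast_le] at hsum

end OrthonormalColumns

section Interpolation

variable {m n K : Type*} [Fintype m] [DecidableEq m] [Field K]

theorem injective_of_det_submatrix_ne_zero {W : Matrix n m K} {f : m → n}
    (h : (W.submatrix f id).det ≠ 0) : f.Injective := by
  intro i j hij
  by_contra hne
  exact h (Matrix.det_zero_of_row_eq hne (by ext l; simp [hij]))

variable [DecidableEq n]

/-- The coefficients, supported on the range of `f`, of the combination of the rows of `W` that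
equals `u`. They are given by Cramer's rule, and are `0` if the rows `W (f j)` are not a basis. -/
def interpVec (W : Matrix n m K) (f : m → n) (u : m → K) : n → K := fun i =>
  if i ∈ Set.range f then
    ((W.updateRow i u).submatrix f id).det / (W.submatrix f id).det
  else 0

theorem interpVec_apply_of_notMem_range (W : Matrix n m K) {f : m → n} (u : m → K) {i : n}
    (hi : i ∉ Set.range f) : interpVec W f u i = 0 :=
  if_neg hi

theorem interpVec_apply_of_row_eq_zero {W : Matrix n m K} (f : m → n) (u : m → K) {i : n}
    (hi : W i = 0) : interpVec W f u i = 0 := by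
  unfold interpVec
  split_ifs with hmem
  · obtain ⟨j, rfl⟩ := hmem
    have hdet : (W.submatrix f id).det = 0 :=
      Matrix.det_eq_zero_of_row_eq_zero j fun l => congrFun hi l
    rw [hdet, div_zero]
  · rfl

theorem interpVec_apply_of_injective (W : Matrix n m K) {f : m → n} (hf : f.Injective) (u : m → K)
    (j : m) : interpVec W f u (f j) =
      (W.submatrix f id)ᵀ.cramer u j / (W.submatrix f id).det := by
  have hrow : (W.updateRow (f j) u).submatrix f id = (W.submatrix f id).updateRow j u := by
    ext a l
    by_cases ha : a = j
    · simp [ha]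
    · simp [Matrix.updateRow_ne ha, Matrix.updateRow_ne (hf.ne ha)]
  rw [interpVec, if_pos (Set.mem_range_self j), hrow, Matrix.cramer_transpose_apply]

theorem transpose_mulVec_interpVec [Fintype n] {W : Matrix n m K} {f : m → n}
    (h : (W.submatrix f id).det ≠ 0) (u : m → K) : Wᵀ *ᵥ interpVec W f u = u := by
  have hf := injective_of_det_submatrix_ne_zero h
  ext l
  calc (Wᵀ *ᵥ interpVec W f u) l
      = ∑ j, W (f j) l * interpVec W f u (f j) := by
        rw [Matrix.mulVec, dotProduct,
          ← Finset.sum_subset (Finset.subset_univ (Finset.univ.image f)) fun i _ hi => ?_,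
          Finset.sum_image hf.injOn]
        · rfl
        · rw [interpVec_apply_of_notMem_range W u (by simpa using hi), mul_zero]
    _ = ((W.submatrix f id)ᵀ *ᵥ (W.submatrix f id)ᵀ.cramer u) l / (W.submatrix f id).det := by
        simp only [interpVec_apply_of_injective W hf, Matrix.mulVec, dotProduct, Finset.sum_div,
          mul_div_assoc, Matrix.transpose_apply, Matrix.submatrix_apply, id_eq]
    _ = u l := by
        rw [Matrix.mulVec_cramer, Matrix.det_transpose, Pi.smul_apply, smul_eq_mul,
          mul_div_cancel_left₀ _ h]

end Interpolation

section VolumeSampling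

variable {m n : Type*} [Fintype m] [DecidableEq m]

/-- If `W` has orthonormal columns, `volumeWeight W` is the law of a uniformly random enumeration of
the determinantal point process with kernel `W Wᵀ`. -/
noncomputable def volumeWeight (W : Matrix n m ℝ) (f : m → n) : ℝ :=
  (W.submatrix f id).det ^ 2 / (Fintype.card m)!

theorem volumeWeight_nonneg (W : Matrix n m ℝ) (f : m → n) : 0 ≤ volumeWeight W f := by
  unfold volumeWeight
  positivity

variable [Fintype n]

theorem sum_volumeWeight {W : Matrix n m ℝ} (hW : Wᵀ * W = 1) : ∑ f, volumeWeight W f = 1 := by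
  simp only [volumeWeight, sq]
  rw [← Finset.sum_div, sum_det_submatrix_mul_det_submatrix, hW, Matrix.det_one, mul_one,
    div_self (Nat.cast_ne_zero.2 (Nat.factorial_ne_zero _))]

variable [DecidableEq n]

theorem sum_volumeWeight_mul_interpVec_apply {W : Matrix n m ℝ} (hW : Wᵀ * W = 1) (u : m → ℝ)
    (i : n) : ∑ f, volumeWeight W f * interpVec W f u i = W i ⬝ᵥ u := by
  have hterm (f : m → n) : volumeWeight W f * interpVec W f u i =
      (if i ∈ Set.range f then ((W.updateRow i (W i)).submatrix f id).det *
        ((W.updateRow i u).submatrix f id).det else 0) / (Fintype.card m)! := by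
    rw [volumeWeight, interpVec, Matrix.updateRow_eq_self]
    by_cases h : (W.submatrix f id).det = 0
    · simp [h]
    · split_ifs
      · field_simp
      · simp
  rw [Finset.sum_congr rfl fun f _ => hterm f, ← Finset.sum_div,
    sum_det_updateRow_mul_det_updateRow hW, mul_div_cancel_left₀ _ (by positivity)]
  ring

theorem sum_volumeWeight_mul_interpVec_apply_sq_le {W : Matrix n m ℝ} (hW : Wᵀ * W = 1)
    (u : m → ℝ) (i : n) : ∑ f, volumeWeight W f * interpVec W f u i ^ 2 ≤
      (1 - W i ⬝ᵥ W i) * (u ⬝ᵥ u) + (W i ⬝ᵥ u) ^ 2 := by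
  have hterm (f : m → n) : volumeWeight W f * interpVec W f u i ^ 2 ≤
      (if i ∈ Set.range f then ((W.updateRow i u).submatrix f id).det *
        ((W.updateRow i u).submatrix f id).det else 0) / (Fintype.card m)! := by
    rw [volumeWeight, interpVec, ← sq]
    split_ifs
    · by_cases h : (W.submatrix f id).det = 0
      · rw [h, zero_pow two_ne_zero, zero_div, zero_mul]
        positivity
      · exact le_of_eq (by field_simp)
    · simp
  refine (Finset.sum_le_sum fun f _ => hterm f).trans (le_of_eq ?_)
  rw [← Finset.sum_div, sum_det_updateRow_mul_det_updateRow hW,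
    mul_div_cancel_left₀ _ (by positivity), ← sq]

theorem sum_volumeWeight_mul_interpVec_dotProduct_self_le {W : Matrix n m ℝ} (hW : Wᵀ * W = 1)
    (u : m → ℝ) : ∑ f, volumeWeight W f * (interpVec W f u ⬝ᵥ interpVec W f u) ≤
      ({i | W i ≠ 0}.ncard - Fintype.card m + 1) * (u ⬝ᵥ u) := by
  have hcoord (i : n) : ∑ f, volumeWeight W f * interpVec W f u i ^ 2 ≤
      (if W i ≠ 0 then 1 else 0) * (u ⬝ᵥ u) - (W i ⬝ᵥ W i) * (u ⬝ᵥ u) + (W i ⬝ᵥ u) ^ 2 := by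
    split_ifs with hi
    · exact (sum_volumeWeight_mul_interpVec_apply_sq_le hW u i).trans (le_of_eq (by ring))
    · simp [interpVec_apply_of_row_eq_zero _ u (not_ne_iff.1 hi), not_ne_iff.1 hi]
  have hparseval : ∑ i, (W i ⬝ᵥ u) ^ 2 = u ⬝ᵥ u := by
    simp only [sq]
    exact mulVec_dotProduct_mulVec hW u u
  calc ∑ f, volumeWeight W f * (interpVec W f u ⬝ᵥ interpVec W f u)
      = ∑ i, ∑ f, volumeWeight W f * interpVec W f u i ^ 2 := by
        rw [Finset.sum_comm]
        simp only [dotProduct, Finset.mul_sum, sq]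
    _ ≤ ∑ i, ((if W i ≠ 0 then 1 else 0) * (u ⬝ᵥ u) - (W i ⬝ᵥ W i) * (u ⬝ᵥ u) +
          (W i ⬝ᵥ u) ^ 2) := Finset.sum_le_sum fun i _ => hcoord i
    _ = ({i | W i ≠ 0}.ncard - Fintype.card m + 1) * (u ⬝ᵥ u) := by
        rw [Finset.sum_add_distrib, Finset.sum_sub_distrib, ← Finset.sum_mul, ← Finset.sum_mul,
          hparseval, sum_row_dotProduct_self hW, sum_ite_row_ne_zero]
        ring

theorem sum_volumeWeight_mul_sub_interpVec_dotProduct_self_le {W : Matrix n m ℝ}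
    (hW : Wᵀ * W = 1) (w : n → ℝ) :
    ∑ f, volumeWeight W f *
        ((w - interpVec W f (Wᵀ *ᵥ w)) ⬝ᵥ (w - interpVec W f (Wᵀ *ᵥ w))) ≤
      max 1 ({i | W i ≠ 0}.ncard - Fintype.card m : ℝ) * (w ⬝ᵥ w) := by
  set u := Wᵀ *ᵥ w with hu
  set r : ℝ := {i | W i ≠ 0}.ncard - Fintype.card m
  have hunbiased : ∑ f, volumeWeight W f * (w ⬝ᵥ interpVec W f u) = u ⬝ᵥ u := by
    calc ∑ f, volumeWeight W f * (w ⬝ᵥ interpVec W f u)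
        = ∑ i, w i * ∑ f, volumeWeight W f * interpVec W f u i := by
          simp only [dotProduct, Finset.mul_sum]
          rw [Finset.sum_comm]
          simp only [mul_left_comm]
      _ = w ⬝ᵥ W *ᵥ u := by
          simp only [sum_volumeWeight_mul_interpVec_apply hW]
          rfl
      _ = u ⬝ᵥ u := by rw [Matrix.dotProduct_mulVec, ← Matrix.mulVec_transpose, ← hu]
  have hsecond := sum_volumeWeight_mul_interpVec_dotProduct_self_le hW u
  have hbessel : u ⬝ᵥ u ≤ w ⬝ᵥ w := transpose_mulVec_dotProduct_self_le hW w
  calc ∑ f, volumeWeight W f * ((w - interpVec W f u) ⬝ᵥ (w - interpVec W f u))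
      = w ⬝ᵥ w - 2 * (u ⬝ᵥ u) + ∑ f, volumeWeight W f * (interpVec W f u ⬝ᵥ interpVec W f u) := by
        rw [← hunbiased, ← one_mul (w ⬝ᵥ w), ← sum_volumeWeight hW, Finset.sum_mul, Finset.mul_sum,
          ← Finset.sum_sub_distrib, ← Finset.sum_add_distrib]
        refine Finset.sum_congr rfl fun f _ => ?_
        rw [sub_dotProduct, dotProduct_sub, dotProduct_sub, dotProduct_comm (interpVec W f u) w]
        ring
    _ ≤ w ⬝ᵥ w + (r - 1) * (u ⬝ᵥ u) := by linarith
    _ ≤ w ⬝ᵥ w + (max 1 r - 1) * (w ⬝ᵥ w) := by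
        have hr : r - 1 ≤ max 1 r - 1 := by gcongr; exact le_max_right 1 r
        have hmax : 0 ≤ max 1 r - 1 := sub_nonneg.2 (le_max_left 1 r)
        have huu := dotProduct_self_nonneg u
        gcongr
    _ = max 1 r * (w ⬝ᵥ w) := by ring

end VolumeSampling

section ProjectionDPP

variable {m n : Type*} [Fintype m]

theorem det_mul_eq_zero_of_card_lt {R : Type*} [CommRing R] [Fintype n] [DecidableEq n]
    (A : Matrix n m R) (B : Matrix m n R) (h : Fintype.card m < Fintype.card n) :
    (A * B).det = 0 := by
  rw [← Matrix.transpose_transpose A, det_transpose_mul_eq_sum]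
  refine Finset.sum_eq_zero fun f _ => ?_
  obtain ⟨i, j, hne, hij⟩ := Fintype.exists_ne_map_eq_of_card_lt f h
  rw [Matrix.det_zero_of_row_eq hne (by ext l; simp [hij]), mul_zero]

theorem exists_equiv_of_image_eq [DecidableEq n] {S : Finset n} (hS : S.card = Fintype.card m)
    {f : m → n} (hf : Finset.univ.image f = S) : ∃ e : m ≃ S, (fun j => (e j : n)) = f := by
  have hmem (j : m) : f j ∈ S := hf ▸ Finset.mem_image_of_mem f (Finset.mem_univ j)
  have hsurj : Function.Surjective fun j => (⟨f j, hmem j⟩ : S) := by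
    rintro ⟨i, hi⟩
    obtain ⟨j, -, rfl⟩ := Finset.mem_image.1 (hf ▸ hi)
    exact ⟨j, rfl⟩
  have hbij := (Fintype.bijective_iff_surjective_and_card _).2
    ⟨hsurj, hS.symm.trans (Fintype.card_coe S).symm⟩
  exact ⟨Equiv.ofBijective _ hbij, rfl⟩

variable {d : ℕ} {W : Matrix (Fin d) m ℝ} {μ : PMF (Finset (Fin d))}

theorem sum_toReal_eq_one {α : Type*} [Fintype α] (p : PMF α) : ∑ x, (p x).toReal = 1 := by
  rw [← ENNReal.toReal_sum fun x _ => p.apply_ne_top x, ← tsum_fintype (L := .unconditional _),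
    p.tsum_coe, ENNReal.toReal_one]

theorem IsDPP.toReal_eq_zero_of_card_lt (hμ : IsDPP (W * Wᵀ) μ) {S : Finset (Fin d)}
    (hS : Fintype.card m < S.card) : (μ S).toReal = 0 := by
  have hminor := hμ S
  rw [Matrix.submatrix_mul W Wᵀ _ id _ Function.bijective_id,
    det_mul_eq_zero_of_card_lt _ _ (by simpa using hS)] at hminor
  exact (Finset.sum_eq_zero_iff_of_nonneg fun _ _ => ENNReal.toReal_nonneg).1 hminor S (by simp)

variable [DecidableEq m]

theorem card_filter_image_eq [Fintype n] [DecidableEq n] {S : Finset n}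
    (hS : S.card = Fintype.card m) :
    (Finset.univ.filter fun f : m → n => Finset.univ.image f = S).card = (Fintype.card m)! := by
  have e₀ : m ≃ S := Fintype.equivOfCardEq (hS.symm.trans (Fintype.card_coe S).symm)
  rw [← Fintype.card_equiv e₀, ← Finset.card_univ]
  symm
  refine Finset.card_bij (fun (e : m ≃ S) _ j => (e j : n)) (fun e _ => ?_)
    (fun e _ e' _ h => ?_) fun f hf => ?_
  · refine Finset.mem_filter.2 ⟨Finset.mem_univ _, Finset.ext fun i => ?_⟩
    simpa using ⟨fun ⟨j, hj⟩ => hj ▸ (e j).2, fun hi => ⟨e.symm ⟨i, hi⟩, by simp⟩⟩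
  · exact Equiv.ext fun j => Subtype.ext (congrFun h j)
  · obtain ⟨e, he⟩ := exists_equiv_of_image_eq hS (Finset.mem_filter.1 hf).2
    exact ⟨e, Finset.mem_univ e, he⟩

theorem card_image_of_det_submatrix_ne_zero {K : Type*} [Field K] [DecidableEq n]
    {W : Matrix n m K} {f : m → n} (h : (W.submatrix f id).det ≠ 0) :
    (Finset.univ.image f).card = Fintype.card m :=
  Finset.card_image_of_injective _ (injective_of_det_submatrix_ne_zero h)

theorem IsDPP.toReal_eq_sq_det (hμ : IsDPP (W * Wᵀ) μ) {S : Finset (Fin d)} (e : m ≃ S) :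
    (μ S).toReal = (W.submatrix (fun j => (e j : Fin d)) id).det ^ 2 := by
  have hcard : S.card = Fintype.card m :=
    (Fintype.card_coe S).symm.trans (Fintype.card_congr e).symm
  have honly : ∑ T with S ⊆ T, (μ T).toReal = (μ S).toReal := by
    refine Finset.sum_eq_single_of_mem S (by simp) fun T hT hne => ?_
    refine hμ.toReal_eq_zero_of_card_lt (hcard ▸ Finset.card_lt_card ?_)
    exact Finset.ssubset_iff_subset_ne.2 ⟨(Finset.mem_filter.1 hT).2, hne.symm⟩
  rw [← honly, hμ S, ← Matrix.det_submatrix_equiv_self e, Matrix.submatrix_submatrix,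
    Matrix.submatrix_mul W Wᵀ _ id _ Function.bijective_id, Matrix.det_mul,
    ← Matrix.transpose_submatrix, Matrix.det_transpose, sq]
  rfl

theorem IsDPP.sum_volumeWeight_image_eq (hμ : IsDPP (W * Wᵀ) μ) (S : Finset (Fin d)) :
    ∑ f : m → Fin d with Finset.univ.image f = S, volumeWeight W f =
      if S.card = Fintype.card m then (μ S).toReal else 0 := by
  split_ifs with hS
  · have hweight : ∀ f ∈ Finset.univ.filter (fun f : m → Fin d => Finset.univ.image f = S),
        volumeWeight W f = (μ S).toReal / (Fintype.card m)! := fun f hf => by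
      obtain ⟨e, rfl⟩ := exists_equiv_of_image_eq hS (Finset.mem_filter.1 hf).2
      rw [volumeWeight, hμ.toReal_eq_sq_det e]
    rw [Finset.sum_congr rfl hweight, Finset.sum_const, card_filter_image_eq hS, nsmul_eq_mul,
      mul_div_cancel₀ _ (Nat.cast_ne_zero.2 (Nat.factorial_ne_zero _))]
  · refine Finset.sum_eq_zero fun f hf => ?_
    have hdet : (W.submatrix f id).det = 0 := by
      by_contra h
      exact hS ((Finset.mem_filter.1 hf).2 ▸ card_image_of_det_submatrix_ne_zero h)
    rw [volumeWeight, hdet, zero_pow two_ne_zero, zero_div]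

/-- Sets of the wrong size have probability zero because the others already exhaust the total mass,
by the Cauchy–Binet formula. -/
theorem IsDPP.toReal_eq_sum_volumeWeight (hW : Wᵀ * W = 1) (hμ : IsDPP (W * Wᵀ) μ)
    (S : Finset (Fin d)) :
    (μ S).toReal = ∑ f : m → Fin d with Finset.univ.image f = S, volumeWeight W f := by
  have hle : ∀ T ∈ Finset.univ, ∑ f : m → Fin d with Finset.univ.image f = T, volumeWeight W f ≤
      (μ T).toReal := fun T _ => by
    rw [hμ.sum_volumeWeight_image_eq]
    split_ifs
    exacts [le_rfl, ENNReal.toReal_nonneg]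
  have htotal : ∑ T, ∑ f : m → Fin d with Finset.univ.image f = T, volumeWeight W f =
      ∑ T, (μ T).toReal := by
    rw [Finset.sum_fiberwise, sum_volumeWeight hW, sum_toReal_eq_one]
  exact ((Finset.sum_eq_sum_iff_of_le hle).1 htotal S (Finset.mem_univ S)).symm

theorem IsDPP.expect_eq_sum_volumeWeight (hW : Wᵀ * W = 1) (hμ : IsDPP (W * Wᵀ) μ)
    (F : Finset (Fin d) → ℝ) :
    expect μ F = ∑ f : m → Fin d, volumeWeight W f * F (Finset.univ.image f) := by
  rw [expect, ← Finset.sum_fiberwise Finset.univ fun f : m → Fin d => Finset.univ.image f]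
  refine Finset.sum_congr rfl fun S _ => ?_
  rw [hμ.toReal_eq_sum_volumeWeight hW, Finset.sum_mul]
  exact Finset.sum_congr rfl fun f hf => by rw [(Finset.mem_filter.1 hf).2]

end ProjectionDPP

section SingularValues

variable {N d a b k : ℕ}

/-- The `a × b` matrix with the entries of the sequence `s` on its diagonal, which is truncated
after `min a b` terms. -/
def rectDiagonal (a b : ℕ) (s : ℕ → ℝ) : Matrix (Fin a) (Fin b) ℝ :=
  Matrix.of fun i j => if (i : ℕ) = j then s j else 0

theorem rectDiagonal_transpose_mul_self (s : ℕ → ℝ) :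
    (rectDiagonal a b s)ᵀ * rectDiagonal a b s =
      Matrix.diagonal fun j : Fin b => if (j : ℕ) < a then s j ^ 2 else 0 := by
  ext i j
  simp only [Matrix.mul_apply, Matrix.transpose_apply, rectDiagonal, Matrix.of_apply,
    Matrix.diagonal_apply]
  by_cases hi : (i : ℕ) < a
  · rw [Finset.sum_eq_single_of_mem ⟨i, hi⟩ (Finset.mem_univ _) fun x _ hx => by
      rw [if_neg fun h => hx (Fin.ext h), zero_mul]]
    by_cases hij : i = j
    · simp [hij, hij ▸ hi, sq]
    · simp [hij, Fin.val_ne_of_ne hij]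
  · rw [Finset.sum_eq_zero fun x _ => by rw [if_neg (by omega), zero_mul], if_neg hi, ite_self]

theorem rectDiagonal_mulVec_dotProduct_self_le {s : ℕ → ℝ} {c : ℝ} {t : Fin b → ℝ}
    (h : ∀ j, t j ≠ 0 → s j ^ 2 ≤ c) :
    rectDiagonal a b s *ᵥ t ⬝ᵥ rectDiagonal a b s *ᵥ t ≤ c * (t ⬝ᵥ t) := by
  rw [Matrix.dotProduct_mulVec, ← Matrix.mulVec_transpose, Matrix.mulVec_mulVec,
    rectDiagonal_transpose_mul_self, dotProduct, dotProduct, Finset.mul_sum]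
  refine Finset.sum_le_sum fun j _ => ?_
  rw [Matrix.mulVec_diagonal, mul_assoc]
  by_cases hj : t j = 0
  · simp only [hj, mul_zero, le_refl]
  · have hc : 0 ≤ c := (sq_nonneg (s j)).trans (h j hj)
    refine mul_le_mul_of_nonneg_right ?_ (mul_self_nonneg (t j))
    split_ifs
    exacts [h j hj, hc]

theorem sigma_nonneg (X : Matrix (Fin N) (Fin d) ℝ) (j : ℕ) : 0 ≤ sigma X j :=
  LinearMap.singularValues_nonneg _ _

theorem sigma_antitone (X : Matrix (Fin N) (Fin d) ℝ) : Antitone (sigma X) := fun _ _ h =>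
  LinearMap.singularValues_antitone _ (Nat.sub_le_sub_right h 1)

theorem firstCols_transpose_mul_self {V : Matrix (Fin d) (Fin b) ℝ} (hV : Vᵀ * V = 1)
    (hk : k ≤ b) : (firstCols V hk)ᵀ * firstCols V hk = 1 := by
  rw [firstCols, Matrix.transpose_submatrix,
    ← Matrix.submatrix_mul Vᵀ V _ id _ Function.bijective_id, hV,
    Matrix.submatrix_one _ (Fin.castLE_injective hk)]

theorem IsSVD.mulVec_dotProduct_self_le {X : Matrix (Fin N) (Fin d) ℝ}
    {U : Matrix (Fin N) (Fin a) ℝ} {V : Matrix (Fin d) (Fin b) ℝ} (h : IsSVD X U V) (hk : k ≤ b)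
    {z : Fin d → ℝ} (hz : (firstCols V hk)ᵀ *ᵥ z = 0) :
    X *ᵥ z ⬝ᵥ X *ᵥ z ≤ sigma X (k + 1) ^ 2 * (z ⬝ᵥ z) := by
  have hle (j : Fin b) (hj : (Vᵀ *ᵥ z) j ≠ 0) : sigma X (j + 1) ^ 2 ≤ sigma X (k + 1) ^ 2 := by
    have hkj : k ≤ j := le_of_not_gt fun hlt => hj (congrFun hz ⟨j, hlt⟩)
    exact pow_le_pow_left₀ (sigma_nonneg X _) (sigma_antitone X (Nat.succ_le_succ hkj)) 2
  have hX : X *ᵥ z = U *ᵥ (rectDiagonal a b fun j => sigma X (j + 1)) *ᵥ Vᵀ *ᵥ z := by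
    rw [Matrix.mulVec_mulVec, Matrix.mulVec_mulVec]
    exact congrArg (· *ᵥ z) h.eq_mul
  calc X *ᵥ z ⬝ᵥ X *ᵥ z ≤ sigma X (k + 1) ^ 2 * (Vᵀ *ᵥ z ⬝ᵥ Vᵀ *ᵥ z) := by
        rw [hX, mulVec_dotProduct_mulVec h.orthonormal_left]
        exact rectDiagonal_mulVec_dotProduct_self_le hle
    _ ≤ sigma X (k + 1) ^ 2 * (z ⬝ᵥ z) := by
        gcongr
        exact transpose_mulVec_dotProduct_self_le h.orthonormal_right z

end SingularValues

section HatMatrix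

theorem trace_eq_rank_of_isIdempotentElem {n K : Type*} [Fintype n] [Field K] {M : Matrix n n K}
    (hM : IsIdempotentElem M) : M.trace = M.rank := by
  classical
  have hproj : LinearMap.IsProj (LinearMap.range M.toLin') M.toLin' :=
    LinearMap.IsIdempotentElem.isProj_range _ (hM.map Matrix.toLinAlgEquiv')
  rw [← Matrix.trace_toLin'_eq, hproj.trace]
  rfl

variable {m n : Type*} [Fintype m] [Fintype n] [DecidableEq n]

/-- The hat matrix of least squares on the columns of `A`, that is, the orthogonal projection onto
the column space of `A`. -/
noncomputable def hatMatrix (A : Matrix m n ℝ) : Matrix m m ℝ := A * pinv A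

theorem hatMatrix_transpose (A : Matrix m n ℝ) : (hatMatrix A)ᵀ = hatMatrix A :=
  (isMoorePenrose_pinv A).transpose_left

theorem hatMatrix_mul (A : Matrix m n ℝ) : hatMatrix A * A = A :=
  (isMoorePenrose_pinv A).mul_mul_left

theorem isIdempotentElem_hatMatrix (A : Matrix m n ℝ) : IsIdempotentElem (hatMatrix A) := by
  rw [IsIdempotentElem]
  nth_rewrite 2 [hatMatrix]
  rw [← Matrix.mul_assoc, hatMatrix_mul, hatMatrix]

theorem hatMatrix_mulVec_dotProduct_hatMatrix_mulVec (A : Matrix m n ℝ) (x y : m → ℝ) :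
    hatMatrix A *ᵥ x ⬝ᵥ hatMatrix A *ᵥ y = x ⬝ᵥ hatMatrix A *ᵥ y := by
  rw [dotProduct_comm, Matrix.dotProduct_mulVec, ← Matrix.mulVec_transpose, hatMatrix_transpose,
    Matrix.mulVec_mulVec, (isIdempotentElem_hatMatrix A).eq, dotProduct_comm]

theorem sub_hatMatrix_mulVec_dotProduct_self_le (A : Matrix m n ℝ) (x : m → ℝ) (z : n → ℝ) :
    (x - hatMatrix A *ᵥ x) ⬝ᵥ (x - hatMatrix A *ᵥ x) ≤ (x - A *ᵥ z) ⬝ᵥ (x - A *ᵥ z) := by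
  set r := x - A *ᵥ z with hr
  have hres : x - hatMatrix A *ᵥ x = r - hatMatrix A *ᵥ r := by
    rw [hr, Matrix.mulVec_sub, Matrix.mulVec_mulVec, hatMatrix_mul]
    abel
  have hproj := hatMatrix_mulVec_dotProduct_hatMatrix_mulVec A r r
  have hnonneg := dotProduct_self_nonneg (hatMatrix A *ᵥ r)
  rw [hres]
  simp only [sub_dotProduct, dotProduct_sub, dotProduct_comm (hatMatrix A *ᵥ r) r, hproj] at *
  linarith

theorem sub_hatMatrix_mulVec_add_dotProduct_self (A : Matrix m n ℝ) (x e : m → ℝ) :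
    (x - hatMatrix A *ᵥ (x + e)) ⬝ᵥ (x - hatMatrix A *ᵥ (x + e)) =
      (x - hatMatrix A *ᵥ x) ⬝ᵥ (x - hatMatrix A *ᵥ x) + e ⬝ᵥ hatMatrix A *ᵥ e := by
  obtain ⟨r, hr⟩ : ∃ r, r = x - hatMatrix A *ᵥ x := ⟨_, rfl⟩
  have horth : r ⬝ᵥ hatMatrix A *ᵥ e = 0 := by
    rw [hr, sub_dotProduct, hatMatrix_mulVec_dotProduct_hatMatrix_mulVec, sub_self]
  rw [Matrix.mulVec_add, ← sub_sub, ← hr, sub_dotProduct, dotProduct_sub, dotProduct_sub,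
    dotProduct_comm (hatMatrix A *ᵥ e) r, horth, hatMatrix_mulVec_dotProduct_hatMatrix_mulVec]
  ring

theorem trace_hatMatrix_le (A : Matrix m n ℝ) : (hatMatrix A).trace ≤ Fintype.card n := by
  rw [trace_eq_rank_of_isIdempotentElem (isIdempotentElem_hatMatrix A), Nat.cast_le]
  exact (Matrix.rank_mul_le_left A (pinv A)).trans (Matrix.rank_le_card_width A)

end HatMatrix

section Risk

theorem dotProduct_mulVec_eq_sum {ι R : Type*} [Fintype ι] [CommSemiring R] (Q : Matrix ι ι R)
    (x : ι → R) : x ⬝ᵥ Q *ᵥ x = ∑ i, ∑ j, Q i j * (x i * x j) := by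
  simp only [Matrix.mulVec, dotProduct, Finset.mul_sum, mul_left_comm]

theorem norm_toLp_sq {ι : Type*} [Fintype ι] (x : ι → ℝ) : ‖WithLp.toLp 2 x‖ ^ 2 = x ⬝ᵥ x := by
  rw [EuclideanSpace.real_norm_sq_eq]
  exact Finset.sum_congr rfl fun i _ => sq _

variable {ι Ω : Type*} [DecidableEq ι] [MeasurableSpace Ω] {P : Measure Ω} {v : ℝ}

/-- Square-integrable noise whose matrix of second moments is `v` times the identity: the part of
`IsIIDNoise` that determines the expectation of a quadratic form in the noise. -/
structure IsIsotropicNoise (P : Measure Ω) (ξ : ι → Ω → ℝ) (v : ℝ) : Prop where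
  memLp : ∀ i, MemLp (ξ i) 2 P
  integral_mul : ∀ i j, ∫ ω, ξ i ω * ξ j ω ∂P = if i = j then v else 0

theorem IsIIDNoise.isIsotropicNoise {N : ℕ} {ξ : Fin N → Ω → ℝ} (hξ : IsIIDNoise P ξ v) :
    IsIsotropicNoise P ξ v where
  memLp := hξ.memLp
  integral_mul i j := by
    split_ifs with h
    · rw [← h, ← hξ.variance i,
        variance_of_integral_eq_zero (hξ.memLp i).aemeasurable (hξ.mean i)]
      simp only [sq]
    · have hprod := (hξ.indep.indepFun h).integral_mul_eq_mul_integral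
        (hξ.memLp i).aestronglyMeasurable (hξ.memLp j).aestronglyMeasurable
      rw [hξ.mean, zero_mul] at hprod
      exact hprod

theorem IsIsotropicNoise.nonneg [Nonempty ι] {ξ : ι → Ω → ℝ} (hξ : IsIsotropicNoise P ξ v) :
    0 ≤ v := by
  obtain ⟨i⟩ := ‹Nonempty ι›
  have hdiag := hξ.integral_mul i i
  rw [if_pos rfl] at hdiag
  exact hdiag ▸ integral_nonneg fun ω => mul_self_nonneg (ξ i ω)

variable [Fintype ι] {ξ : ι → Ω → ℝ}

theorem IsIsotropicNoise.integrable_quadratic (hξ : IsIsotropicNoise P ξ v) (Q : Matrix ι ι ℝ) :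
    Integrable (fun ω => (ξ · ω) ⬝ᵥ Q *ᵥ (ξ · ω)) P := by
  simp only [dotProduct_mulVec_eq_sum]
  exact integrable_finsetSum _ fun i _ => integrable_finsetSum _ fun j _ =>
    ((hξ.memLp i).integrable_mul (hξ.memLp j)).const_mul (Q i j)

theorem IsIsotropicNoise.integral_quadratic (hξ : IsIsotropicNoise P ξ v) (Q : Matrix ι ι ℝ) :
    ∫ ω, (ξ · ω) ⬝ᵥ Q *ᵥ (ξ · ω) ∂P = v * Q.trace := by
  have hint (i j : ι) : Integrable (fun ω => Q i j * (ξ i ω * ξ j ω)) P :=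
    ((hξ.memLp i).integrable_mul (hξ.memLp j)).const_mul (Q i j)
  simp only [dotProduct_mulVec_eq_sum]
  rw [integral_finsetSum _ fun i _ => integrable_finsetSum _ fun j _ => hint i j]
  simp only [integral_finsetSum _ fun j _ => hint _ j, integral_const_mul, hξ.integral_mul,
    mul_ite, mul_zero, Finset.sum_ite_eq, Finset.mem_univ, if_true, Matrix.trace, Matrix.diag_apply,
    Finset.sum_mul, mul_comm v]

variable {N d : ℕ} {η : Fin N → Ω → ℝ}

theorem samplingMatrix_mulVec {S : Finset (Fin d)} {q : Fin d → ℝ} (hq : ∀ i ∉ S, q i = 0) :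
    samplingMatrix S *ᵥ (fun i : S => q i) = q := by
  ext i
  simp only [samplingMatrix, Matrix.mulVec, dotProduct, Matrix.submatrix_apply, id_eq,
    Matrix.one_apply, ite_mul, one_mul, zero_mul]
  rw [Finset.sum_coe_sort S (fun j => if i = j then q j else 0), Finset.sum_ite_eq]
  split_ifs with hi
  exacts [rfl, (hq i hi).symm]

theorem excessRisk_sparseOLS [IsProbabilityMeasure P] (hη : IsIsotropicNoise P η v)
    (X : Matrix (Fin N) (Fin d) ℝ) (w : EuclideanSpace ℝ (Fin d)) (S : Finset (Fin d)) :
    excessRisk P X w η (sparseOLS X S) =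
      ((X *ᵥ w.ofLp - hatMatrix (X * samplingMatrix S) *ᵥ X *ᵥ w.ofLp) ⬝ᵥ
          (X *ᵥ w.ofLp - hatMatrix (X * samplingMatrix S) *ᵥ X *ᵥ w.ofLp) +
        v * (hatMatrix (X * samplingMatrix S)).trace) / N := by
  set H := hatMatrix (X * samplingMatrix S) with hH
  set x := X *ᵥ w.ofLp with hx
  have herror (ω : Ω) : ‖Matrix.toEuclideanLin X w -
      Matrix.toEuclideanLin X (sparseOLS X S (response X w (η · ω)))‖ ^ 2 =
      (x - H *ᵥ x) ⬝ᵥ (x - H *ᵥ x) + (η · ω) ⬝ᵥ H *ᵥ (η · ω) := by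
    rw [hH, ← sub_hatMatrix_mulVec_add_dotProduct_self, ← norm_toLp_sq]
    congr 2
    simp [sparseOLS, response, hatMatrix, hx, Matrix.toLpLin_apply, Matrix.mulVec_mulVec,
      Matrix.mul_assoc]
  simp only [excessRisk, herror]
  rw [integral_div, integral_add (integrable_const _) (hη.integrable_quadratic H),
    hη.integral_quadratic, integral_const, probReal_univ, one_smul]

theorem excessRisk_sparseOLS_le [IsProbabilityMeasure P] (hη : IsIsotropicNoise P η v)
    (X : Matrix (Fin N) (Fin d) ℝ) (w : EuclideanSpace ℝ (Fin d)) {S : Finset (Fin d)}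
    {q : Fin d → ℝ} (hq : ∀ i ∉ S, q i = 0) :
    excessRisk P X w η (sparseOLS X S) ≤
      (X *ᵥ (w.ofLp - q) ⬝ᵥ X *ᵥ (w.ofLp - q) + v * S.card) / N := by
  rcases N.eq_zero_or_pos with rfl | hN
  · simp [excessRisk]
  have : Nonempty (Fin N) := Fin.pos_iff_nonempty.1 hN
  have hv := hη.nonneg
  have hbias := sub_hatMatrix_mulVec_dotProduct_self_le (X * samplingMatrix S) (X *ᵥ w.ofLp)
    fun i : S => q i
  rw [← Matrix.mulVec_mulVec _ X, samplingMatrix_mulVec hq, ← Matrix.mulVec_sub] at hbias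
  have hvariance := trace_hatMatrix_le (X * samplingMatrix S)
  rw [Fintype.card_coe] at hvariance
  rw [excessRisk_sparseOLS hη]
  gcongr

end Risk

section Bound

variable {m : Type*} [Fintype m] [DecidableEq m] {Ω : Type*} [MeasurableSpace Ω] {P : Measure Ω}
  [IsProbabilityMeasure P] {N d : ℕ} {X : Matrix (Fin N) (Fin d) ℝ} {W : Matrix (Fin d) m ℝ}
  {μ : PMF (Finset (Fin d))} {ξ : Fin N → Ω → ℝ} {v c : ℝ}

theorem excessRisk_sparseOLS_image_le (hX : ∀ z, Wᵀ *ᵥ z = 0 → X *ᵥ z ⬝ᵥ X *ᵥ z ≤ c * (z ⬝ᵥ z))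
    (hξ : IsIsotropicNoise P ξ v) (w : EuclideanSpace ℝ (Fin d)) {f : m → Fin d}
    (hf : (W.submatrix f id).det ≠ 0) :
    excessRisk P X w ξ (sparseOLS X (Finset.univ.image f)) ≤
      (c * ((w.ofLp - interpVec W f (Wᵀ *ᵥ w.ofLp)) ⬝ᵥ (w.ofLp - interpVec W f (Wᵀ *ᵥ w.ofLp))) +
        v * Fintype.card m) / N := by
  set q := interpVec W f (Wᵀ *ᵥ w.ofLp)
  have hsupp : ∀ i ∉ Finset.univ.image f, q i = 0 := fun i hi =>
    interpVec_apply_of_notMem_range W _ (by simpa using hi)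
  have horth : Wᵀ *ᵥ (w.ofLp - q) = 0 := by
    rw [Matrix.mulVec_sub, transpose_mulVec_interpVec hf, sub_self]
  have hrisk := excessRisk_sparseOLS_le hξ X w hsupp
  rw [card_image_of_det_submatrix_ne_zero hf] at hrisk
  refine hrisk.trans ?_
  gcongr
  exact hX _ horth

theorem IsDPP.expect_excessRisk_sparseOLS_le (hW : Wᵀ * W = 1) (hμ : IsDPP (W * Wᵀ) μ)
    (hc : 0 ≤ c) (hX : ∀ z, Wᵀ *ᵥ z = 0 → X *ᵥ z ⬝ᵥ X *ᵥ z ≤ c * (z ⬝ᵥ z))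
    (hξ : IsIsotropicNoise P ξ v) (w : EuclideanSpace ℝ (Fin d)) :
    expect μ (fun S => excessRisk P X w ξ (sparseOLS X S)) ≤
      max 1 ({i | W i ≠ 0}.ncard - Fintype.card m : ℝ) * (‖w‖ ^ 2 * c / N) +
        v * Fintype.card m / N := by
  set q := fun f => interpVec W f (Wᵀ *ᵥ w.ofLp)
  have hterm (f : m → Fin d) :
      volumeWeight W f * excessRisk P X w ξ (sparseOLS X (Finset.univ.image f)) ≤
        volumeWeight W f * ((w.ofLp - q f) ⬝ᵥ (w.ofLp - q f)) * (c / N) +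
          volumeWeight W f * (v * Fintype.card m / N) := by
    by_cases hf : (W.submatrix f id).det = 0
    · simp [volumeWeight, hf]
    · refine (mul_le_mul_of_nonneg_left (excessRisk_sparseOLS_image_le hX hξ w hf)
        (volumeWeight_nonneg W f)).trans (le_of_eq ?_)
      ring
  have hnorm : ‖w‖ ^ 2 = w.ofLp ⬝ᵥ w.ofLp := norm_toLp_sq w.ofLp
  calc expect μ (fun S => excessRisk P X w ξ (sparseOLS X S))
      = ∑ f, volumeWeight W f * excessRisk P X w ξ (sparseOLS X (Finset.univ.image f)) :=
        hμ.expect_eq_sum_volumeWeight hW _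
    _ ≤ (∑ f, volumeWeight W f * ((w.ofLp - q f) ⬝ᵥ (w.ofLp - q f))) * (c / N) +
          v * Fintype.card m / N := by
        refine (Finset.sum_le_sum fun f _ => hterm f).trans (le_of_eq ?_)
        rw [Finset.sum_add_distrib, ← Finset.sum_mul, ← Finset.sum_mul, sum_volumeWeight hW,
          one_mul]
    _ ≤ max 1 ({i | W i ≠ 0}.ncard - Fintype.card m : ℝ) * (w.ofLp ⬝ᵥ w.ofLp) * (c / N) +
          v * Fintype.card m / N := by
        gcongr
        exact sum_volumeWeight_mul_sub_interpVec_dotProduct_self_le hW w.ofLp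
    _ = _ := by rw [hnorm]; ring

theorem max_one_sub_le {k p : ℕ} (hkp : k ≤ p) (hp : k = 0 → p = 0) :
    max 1 ((p : ℝ) - k) ≤ 1 + k * (p - k) := by
  have hsub : (0 : ℝ) ≤ p - k := sub_nonneg.2 (Nat.cast_le.2 hkp)
  have hmul := mul_nonneg k.cast_nonneg hsub
  refine max_le (by linarith) ?_
  rcases k.eq_zero_or_pos with hk | hk
  · simp [hk, hp hk]
  · have hk1 : (1 : ℝ) ≤ k := Nat.one_le_cast.2 hk
    linarith [le_mul_of_one_le_left hsub hk1]

theorem max_one_sparsityLevel_sub_le {k : ℕ} {V : Matrix (Fin d) (Fin k) ℝ} (hV : Vᵀ * V = 1) :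
    max 1 ((sparsityLevel V : ℝ) - k) ≤ 1 + k * (sparsityLevel V - k) := by
  have hle : k ≤ sparsityLevel V := by
    simpa only [Fintype.card_fin, sparsityLevel] using card_le_ncard_row_ne_zero hV
  refine max_one_sub_le hle ?_
  rintro rfl
  have hrow (i : Fin d) : V i = 0 := Subsingleton.elim _ _
  simp [sparsityLevel, hrow]

end Bound

end ColumnSubset

theorem mainTheorem4_general {N d a b k : ℕ} {X : Matrix (Fin N) (Fin d) ℝ}
    {U : Matrix (Fin N) (Fin a) ℝ} {V : Matrix (Fin d) (Fin b) ℝ}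
    (hSVD : ColumnSubset.IsSVD X U V) (hk : k ≤ b) {μ : PMF (Finset (Fin d))}
    (hμ : ColumnSubset.IsDPP
      (ColumnSubset.firstCols V hk * (ColumnSubset.firstCols V hk).transpose) μ)
    {Ω : Type*} [MeasurableSpace Ω] {P : Measure Ω} [IsProbabilityMeasure P]
    {ξ : Fin N → Ω → ℝ} {v : ℝ} (hξ : ColumnSubset.IsIsotropicNoise P ξ v)
    (wstar : EuclideanSpace ℝ (Fin d)) :
    ColumnSubset.expect μ
        (fun S => ColumnSubset.excessRisk P X wstar ξ (ColumnSubset.sparseOLS X S)) ≤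
      max 1 ((ColumnSubset.sparsityLevel (ColumnSubset.firstCols V hk) : ℝ) - k) *
        (‖wstar‖ ^ 2 * ColumnSubset.sigma X (k + 1) ^ 2 / N) + v * k / N := by
  simpa only [Fintype.card_fin, ColumnSubset.sparsityLevel] using hμ.expect_excessRisk_sparseOLS_le
    (ColumnSubset.firstCols_transpose_mul_self hSVD.orthonormal_right hk)
    (sq_nonneg (ColumnSubset.sigma X (k + 1))) (fun _ => hSVD.mulVec_dotProduct_self_le hk)
    hξ wstar

theorem mainTheorem4 {N d a b k : ℕ} (X : Matrix (Fin N) (Fin d) ℝ)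
    (U : Matrix (Fin N) (Fin a) ℝ) (V : Matrix (Fin d) (Fin b) ℝ)
    (hSVD : ColumnSubset.IsSVD X U V) (hk : k ≤ b)
    (μ : PMF (Finset (Fin d)))
    (hμ : ColumnSubset.IsDPP
      (ColumnSubset.firstCols V hk * (ColumnSubset.firstCols V hk).transpose) μ)
    {Ω : Type*} [MeasurableSpace Ω] (P : MeasureTheory.Measure Ω)
    [MeasureTheory.IsProbabilityMeasure P]
    (ξ : Fin N → Ω → ℝ) (v : ℝ) (hξ : ColumnSubset.IsIIDNoise P ξ v)
    (wstar : EuclideanSpace ℝ (Fin d)) :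
    ColumnSubset.expect μ
        (fun S => ColumnSubset.excessRisk P X wstar ξ (ColumnSubset.sparseOLS X S)) ≤
      (1 + (k : ℝ) *
          ((ColumnSubset.sparsityLevel (ColumnSubset.firstCols V hk) : ℝ) - (k : ℝ))) *
        (‖wstar‖ ^ 2 * ColumnSubset.sigma X (k + 1) ^ 2 / (N : ℝ)) + v * (k : ℝ) / (N : ℝ) := by
  refine (mainTheorem4_general hSVD hk hμ hξ.isIsotropicNoise wstar).trans ?_
  gcongr
  exact ColumnSubset.max_one_sparsityLevel_sub_le
    (ColumnSubset.firstCols_transpose_mul_self hSVD.orthonormal_right hk)
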